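/- Conventions. Let $A\in\mathbb Z^{m\times d}$ with $\ker_{\mathbb Z}(A)\cap\mathbb N^d=\{0\}$ (where $0\in\mathbb N$), and let $\mathbb NA\subseteq\mathbb Z^m$ be the affine semigroup generated by the columns of $A$. For $b\in\mathbb Z^m$ let $\mathcal F_{A,b}=\{u\in\mathbb N^d: Au=b\}$, which is a finite set, and let $\mathcal R_{A,b}=\{x\in\mathbb Q_{\ge 0}^d: Ax=b\}$; the dimension of $\mathcal R_{A,b}$ is the dimension of its affine hull. For a finite set $\mathcal M\subset\mathbb Z^d$ write $\pm\mathcal M=\mathcal M\cup(-\mathcal M)$. The fiber graph $\mathcal F_{A,b}(\mathcal M)$ is the graph with node set $\mathcal F_{A,b}$ in which $u,v$ are adjacent if $u-v\in\pm\mathcal M$ and in which every node $w$ additionally gets one loop for every $e\in\pm\mathcal M$ with $w+e\notin\mathcal F_{A,b}$. A finite set $\mathcal M\subset\ker_{\mathbb Z}(A)$ is a Markov basis for $A$ if $\mathcal F_{A,b}(\mathcal M)$ is connected for all $b\in\mathbb NA$. The simple walk on a finite graph $G$ has transition probabilities $S^G_{vw}=(\text{number of edges between } v \text{ and } w)/\deg(v)$,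 where $\deg(v)$ is the number of edges incident to $v$ (a loop counts once). The second largest eigenvalue modulus of $S^G$ is the second entry of the decreasing list of the moduli of its eigenvalues, counted with multiplicity (and $0$ if $G$ has only one node). A sequence $(G_i)_{i\in\mathbb N}$ of finite non-empty graphs with node sets $V_i$, where $\lambda_i$ is the second largest eigenvalue modulus of $S^{G_i}$, is rapidly mixing if there is a polynomial $q\in\mathbb Q_{\ge0}[t]$ such that for all $i\in\mathbb N$, $q(\log|V_i|)>0$ and $\lambda_i\le 1-\frac{1}{q(\log|V_i|)}$. Statement. Let $\mathcal M\subset\ker_{\mathbb Z}(A)$ be a Markov basis for $A$ and let $b\in\mathbb NA$ with $\dim(\mathcal R_{A,b})>0$. Let $(b_i)_{i\in\mathbb N}$ be a sequence in $\mathbb NA$ that has $(p(k)\cdot b)_{k\in\mathbb N}$ as a subsequence for some non-constant polynomial $p\in\mathbb Q[t]$, that is, there are $i_0<i_1<i_2<\cdots$ in $\mathbb N$ with $b_{i_k}=p(k)\cdot b$ for all $k\in\mathbb N$. Then the sequence of fiber graphs $(\mathcal F_{A,b_i}(\mathcal M))_{i\in\mathbb N}$ is not rapidly mixing. -/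

import Mathlib

namespace FiberWalk

/-- A finite-type undirected graph with multiple edges and multiple loops, given by its adjacency
matrix: `mult v w` is the number of edges with endpoints `v` and `w`, and `mult v v` is the number
of loops at `v`. -/
structure Multigraph (V : Type) where
  mult : V → V → ℕ
  symm : ∀ v w, mult v w = mult w v

namespace Multigraph

variable {V : Type}

/-- Any two nodes are joined by a path, and there is at least one node. -/
def Connected (G : Multigraph V) : Prop :=
  Nonempty V ∧ ∀ v w, Relation.ReflTransGen (fun x y => 0 < G.mult x y) v w

/-- The number of edges incident to `v`; a loop counts once. -/
def degree [Fintype V] (G : Multigraph V) (v : V) : ℕ := ∑ w, G.mult v w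

/-- The transition matrix of the simple walk. -/
noncomputable def simpleWalk [Fintype V] (G : Multigraph V) : Matrix V V ℝ :=
  Matrix.of fun v w => (G.mult v w : ℝ) / (G.degree v : ℝ)

end Multigraph

/-- The second largest eigenvalue modulus of a real square matrix: list the moduli of its complex
eigenvalues, with multiplicity, in decreasing order and take the second entry. It is `0` if there
are fewer than two eigenvalues. -/
noncomputable def slem {V : Type} [Fintype V] [DecidableEq V] (S : Matrix V V ℝ) : ℝ :=
  (((S.map (fun x : ℝ => (x : ℂ))).charpoly.roots.map (fun z => ‖z‖)).sort (· ≥ ·)).getD 1 0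

/-- A sequence of finite graphs is rapidly mixing if for some polynomial `p` with nonnegative
rational coefficients, `λ_i ≤ 1 - 1 / p (log |V_i|)` for all `i`. The positivity of
`p (log |V_i|)` makes the quotient meaningful. -/
def RapidlyMixing {V : ℕ → Type} [∀ i, Fintype (V i)] [∀ i, DecidableEq (V i)]
    (G : ∀ i, Multigraph (V i)) : Prop :=
  ∃ p : Polynomial ℚ, (∀ n, 0 ≤ p.coeff n) ∧
    ∀ i, 0 < Polynomial.aeval (Real.log (Fintype.card (V i))) p ∧
      slem (G i).simpleWalk ≤ 1 - 1 / Polynomial.aeval (Real.log (Fintype.card (V i))) p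

/-- The set `±M`. -/
def plusMinus {d : ℕ} (M : Finset (Fin d → ℤ)) : Finset (Fin d → ℤ) :=
  M ∪ M.image (fun v => -v)

theorem neg_mem_plusMinus {d : ℕ} {M : Finset (Fin d → ℤ)} {v : Fin d → ℤ}
    (h : v ∈ plusMinus M) : -v ∈ plusMinus M := by
  simp only [plusMinus, Finset.mem_union, Finset.mem_image] at h ⊢
  rcases h with h | ⟨a, ha, rfl⟩
  · exact Or.inr ⟨v, h, rfl⟩
  · exact Or.inl (by simpa using ha)

/-- The fiber graph `F(M)`: nodes `u, v` are adjacent if `u - v ∈ ±M`, and every node `w` gets a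
loop for every `m ∈ ±M` with `w + m ∉ F`. -/
def fiberGraph {d : ℕ} (F M : Finset (Fin d → ℤ)) : Multigraph F where
  mult u v :=
    (if u.1 - v.1 ∈ plusMinus M then 1 else 0) +
      (if u = v then ((plusMinus M).filter (fun m => u.1 + m ∉ F)).card else 0)
  symm u v := by
    have h : (u.1 - v.1 ∈ plusMinus M) ↔ (v.1 - u.1 ∈ plusMinus M) :=
      ⟨fun h => by simpa using neg_mem_plusMinus h, fun h => by simpa using neg_mem_plusMinus h⟩
    by_cases huv : u = v
    · subst huv; rfl
    · simp only [h, huv, Ne.symm huv, if_false]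

variable {m d : ℕ}

/-- `ker_ℤ(A) ∩ ℕ^d = {0}`. -/
def TrivialNonnegKernel (A : Matrix (Fin m) (Fin d) ℤ) : Prop :=
  ∀ u : Fin d → ℤ, A.mulVec u = 0 → 0 ≤ u → u = 0

theorem fiber_finite (A : Matrix (Fin m) (Fin d) ℤ) (hA : TrivialNonnegKernel A)
    (b : Fin m → ℤ) : {u : Fin d → ℤ | 0 ≤ u ∧ A.mulVec u = b}.Finite := by
  have key : {u : Fin d → ℕ | A.mulVec (fun j => (u j : ℤ)) = b}.Finite := by
    have hanti : IsAntichain (· ≤ ·) {u : Fin d → ℕ | A.mulVec (fun j => (u j : ℤ)) = b} := by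
      intro u hu v hv hne hle
      apply hne
      have h0 := hA ((fun j => (v j : ℤ)) - fun j => (u j : ℤ))
        (by rw [Matrix.mulVec_sub, hu, hv, sub_self])
        (fun j => by simpa using hle j)
      funext j
      have := congrFun h0 j
      simp only [Pi.sub_apply, Pi.zero_apply] at this
      omega
    exact hanti.finite_of_partiallyWellOrderedOn (Set.isPWO_of_wellQuasiOrderedLE _)
  refine (key.image (fun u j => (u j : ℤ))).subset ?_
  rintro u ⟨hu0, hu⟩
  have : (fun j => (((u j).toNat : ℕ) : ℤ)) = u := funext fun j => Int.toNat_of_nonneg (hu0 j)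
  exact ⟨fun j => (u j).toNat, by simpa only [Set.mem_ofPred_eq, this] using hu, this⟩

/-- The fiber `{u ∈ ℕ^d : A u = b}`, as a finite subset of `ℤ^d`. -/
noncomputable def fiber (A : Matrix (Fin m) (Fin d) ℤ) (hA : TrivialNonnegKernel A)
    (b : Fin m → ℤ) : Finset (Fin d → ℤ) :=
  (fiber_finite A hA b).toFinset

/-- The affine semigroup `ℕA` generated by the columns of `A`. -/
def affineSemigroup (A : Matrix (Fin m) (Fin d) ℤ) : AddSubmonoid (Fin m → ℤ) :=
  AddSubmonoid.closure (Set.range fun j : Fin d => fun i : Fin m => A i j)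

/-- A finite set `M ⊆ ker_ℤ(A)` is a Markov basis for `A` if the fiber graph of every
`b ∈ ℕA` is connected. -/
def IsMarkovBasis (A : Matrix (Fin m) (Fin d) ℤ) (hA : TrivialNonnegKernel A)
    (M : Finset (Fin d → ℤ)) : Prop :=
  (∀ v ∈ M, A.mulVec v = 0) ∧
    ∀ b ∈ affineSemigroup A, (fiberGraph (fiber A hA b) M).Connected

/-- The `ℚ`-relaxation `{x ∈ ℚ_{≥0}^d : A x = b}` of the fiber. -/
def relaxedFiber (A : Matrix (Fin m) (Fin d) ℤ) (b : Fin m → ℤ) : Set (Fin d → ℚ) :=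
  {x | 0 ≤ x ∧ (A.map (fun z : ℤ => (z : ℚ))).mulVec x = fun i => (b i : ℚ)}

/-- The dimension of a set of rational points: the dimension of its affine hull. -/
noncomputable def affineDim (P : Set (Fin d → ℚ)) : ℕ :=
  Module.finrank ℚ (affineSpan ℚ P).direction

end FiberWalk

/-! The fiber of `p(k) • b` is long but has few nodes. Its length, measured in a suitable
coordinate, grows linearly in a scale `z`, while its cardinality is at most polynomial in `z`
(`exists_card_fiber_le`). Each step of the walk changes that coordinate by at most a constant `K`.

A symmetric walk with spectral gap `1 / q` on `n` nodes cannot have such length: sublevel or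
superlevel sets of the coordinate must grow by a factor `1 / (1 - 1 / q)` at every step of width
`K`, so the length is `O(K q log n)` (`le_gap_mul_log_card`). If `q` is polynomial in `log n`, this
bound is polylogarithmic in `z`, which contradicts linear growth.

Long fibers come from two distinct points of the relaxation, cleared of denominators to integer
points `X`, `Y` over `N • b`. Along `k = Q * N * τ` one has `p(k) = p(0) + N z` with `z` an integer,
so translating `z • X` and `z • Y` by a point over `p(0) • b` gives two distant nodes. -/

namespace FiberWalk

/-! ### Eigenvalues and quadratic forms -/

open Matrix in
theorem slem_le_pair {V : Type} [Fintype V] [DecidableEq V] {S : Matrix V V ℝ}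
    (hS : S.IsHermitian) {i j : V} (hij : i ≠ j) :
    min (hS.eigenvalues i) (hS.eigenvalues j) ≤ slem S := by
  have hroots : ((S.map (fun x : ℝ => (x : ℂ))).charpoly.roots.map (fun z => ‖z‖)) =
      (Finset.univ.val.map fun k => |hS.eigenvalues k|) := by
    have h1 : (S.map (fun x : ℝ => (x : ℂ))).charpoly =
        (Finset.univ.val.map fun k => (Polynomial.X - Polynomial.C ((hS.eigenvalues k : ℝ) : ℂ))).prod := by
      have := Matrix.charpoly_map S Complex.ofRealHom
      have h2 : S.map (fun x : ℝ => (x : ℂ)) = S.map Complex.ofRealHom := rfl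
      rw [h2, this, hS.charpoly_eq, Polynomial.map_prod]
      change _ = ∏ k, (Polynomial.X - Polynomial.C ((hS.eigenvalues k : ℝ) : ℂ))
      simp
    rw [h1]
    have h3 : (Finset.univ.val.map fun k : V =>
        (Polynomial.X - Polynomial.C ((hS.eigenvalues k : ℝ) : ℂ))) =
        (Finset.univ.val.map fun k : V => ((hS.eigenvalues k : ℝ) : ℂ)).map
          (fun a => Polynomial.X - Polynomial.C a) := by
      simp
    rw [h3, Polynomial.roots_multiset_prod_X_sub_C, Multiset.map_map]
    refine Multiset.map_congr rfl fun k _ => ?_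
    simp
  unfold slem
  rw [hroots]
  set m : Multiset ℝ := Finset.univ.val.map fun k => |hS.eigenvalues k| with hm
  have hle : ({|hS.eigenvalues i|, |hS.eigenvalues j|} : Multiset ℝ) ≤ m := by
    have : ({i, j} : Multiset V) ≤ Finset.univ.val := by
      rw [Multiset.le_iff_subset (by simpa using hij)]
      intro x _; simp
    simpa using Multiset.map_le_map (f := fun k => |hS.eigenvalues k|) this
  by_contra! hlt
  have hsort := Multiset.sort_eq m (· ≥ ·)
  have hpw := Multiset.pairwise_sort m (· ≥ ·)
  generalize m.sort (· ≥ ·) = L at hlt hsort hpw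
  set c := min (hS.eigenvalues i) (hS.eigenvalues j)
  -- Two moduli are at least `c`; a decreasing list whose second entry is below `c` has at most one.
  have hcount : 2 ≤ m.countP (fun x => c ≤ x) := by
    refine le_trans ?_ (Multiset.countP_le_of_le _ hle)
    have hi : c ≤ |hS.eigenvalues i| := (min_le_left _ _).trans (le_abs_self _)
    have hj : c ≤ |hS.eigenvalues j| := (min_le_right _ _).trans (le_abs_self _)
    have : ({|hS.eigenvalues i|, |hS.eigenvalues j|} : Multiset ℝ) =
      |hS.eigenvalues i| ::ₘ |hS.eigenvalues j| ::ₘ 0 := rfl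
    rw [this, Multiset.countP_cons_of_pos _ hi, Multiset.countP_cons_of_pos _ hj]
    simp
  rw [← hsort, Multiset.coe_countP] at hcount
  match L, hlt, hpw, hcount with
  | [], _, _, h => simp at h
  | [a], _, _, h =>
    have := List.countP_le_length (p := fun x => decide (c ≤ x)) (l := [a])
    simp at this h
    omega
  | a :: b' :: t, hlt, hpw, h =>
    have hb : b' < c := by simpa using hlt
    have h0 : (b' :: t).countP (fun x => decide (c ≤ x)) = 0 := by
      rw [List.countP_eq_zero]
      intro x hx
      have hbx : x ≤ b' := by
        rcases List.mem_cons.1 hx with rfl | hx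
        · exact le_rfl
        · exact (List.pairwise_cons.1 (List.pairwise_cons.1 hpw).2).1 x hx
      simpa using lt_of_le_of_lt hbx hb
    rw [List.countP_cons, h0] at h
    split_ifs at h <;> omega

open Matrix in
/-- If the second largest eigenvalue modulus is at most `c`, then the quadratic form is bounded by
`c` on a hyperplane. -/
theorem exists_hyperplane_quadForm_le {V : Type} [Fintype V] [DecidableEq V] [Nonempty V]
    {S : Matrix V V ℝ} (hS : S.IsHermitian) {c : ℝ} (hc : slem S ≤ c) :
    ∃ g : V → ℝ, ∀ w : V → ℝ, g ⬝ᵥ w = 0 → w ⬝ᵥ S.mulVec w ≤ c * (w ⬝ᵥ w) := by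
  -- At most one eigenvalue exceeds `c`; its eigenvector is the normal of the hyperplane.
  obtain ⟨i₀, hi₀⟩ : ∃ i₀, ∀ j, j ≠ i₀ → hS.eigenvalues j ≤ c := by
    by_cases h : ∃ i, c < hS.eigenvalues i
    · obtain ⟨i, hi⟩ := h
      refine ⟨i, fun j hj => ?_⟩
      by_contra! hcj
      have := slem_le_pair hS hj
      exact absurd ((lt_min hcj hi).trans_le this) (not_lt.2 hc)
    · push Not at h
      exact ⟨Classical.arbitrary V, fun j _ => h j⟩
  let U : Matrix V V ℝ := hS.eigenvectorUnitary
  have hU : U * Uᴴ = 1 := Unitary.mul_star_self_of_mem hS.eigenvectorUnitary.2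
  have hSU : S = U * Matrix.diagonal hS.eigenvalues * Uᴴ := by
    have := hS.spectral_theorem
    rw [Unitary.conjStarAlgAut_apply] at this
    exact this
  rw [Matrix.conjTranspose_eq_transpose_of_trivial] at hU hSU
  refine ⟨fun v => U v i₀, fun w hw => ?_⟩
  set y := Uᵀ.mulVec w with hy
  have hyi : y i₀ = 0 := hw
  have hww : w ⬝ᵥ w = ∑ i, y i * y i := by
    have : w ⬝ᵥ (U * Uᵀ).mulVec w = y ⬝ᵥ y := by
      rw [← Matrix.mulVec_mulVec, Matrix.dotProduct_mulVec, ← Matrix.mulVec_transpose]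
    rwa [hU, Matrix.one_mulVec] at this
  have hwS : w ⬝ᵥ S.mulVec w = ∑ i, y i * (hS.eigenvalues i * y i) := by
    conv_lhs => rw [hSU]
    rw [← Matrix.mulVec_mulVec, ← Matrix.mulVec_mulVec, Matrix.dotProduct_mulVec,
      ← Matrix.mulVec_transpose, ← hy]
    simp [dotProduct, Matrix.mulVec_diagonal]
  rw [hww, hwS, Finset.mul_sum]
  refine Finset.sum_le_sum fun i _ => ?_
  by_cases h : i = i₀
  · subst h; simp [hyi]
  · nlinarith [mul_self_nonneg (y i), mul_le_mul_of_nonneg_right (hi₀ i h) (mul_self_nonneg (y i))]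

end FiberWalk

/-! ### Spectral gap against spread -/

namespace FiberWalk

/-- Two far apart sets with small inner boundary force the second largest eigenvalue modulus of a
symmetric stochastic matrix to be large. -/
theorem lt_slem_of_separated {V : Type} [Fintype V] [DecidableEq V] [Nonempty V]
    {P : Matrix V V ℝ} (hP : P.IsHermitian) (h0 : ∀ u v, 0 ≤ P u v) (h1 : ∀ u, ∑ v, P u v = 1)
    {S₀ S₁ T₀ T₁ : Finset V} (hS : S₀ ⊆ S₁) (hT : T₀ ⊆ T₁)
    (hSS : ∀ u ∈ S₀, ∀ v, P u v ≠ 0 → v ∈ S₁) (hTT : ∀ u ∈ T₀, ∀ v, P u v ≠ 0 → v ∈ T₁)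
    (hdisj : ∀ u ∈ S₁, u ∉ T₁) (hST : ∀ u ∈ S₁, ∀ v ∈ T₁, P u v = 0) {c : ℝ}
    (hcS : c * S₁.card < S₀.card) (hcT : c * T₁.card < T₀.card) : c < slem P := by
  by_contra! hc
  obtain ⟨g, hg⟩ := exists_hyperplane_quadForm_le hP hc
  let χ : Finset V → V → ℝ := fun S u => if u ∈ S then 1 else 0
  have hself : ∀ S, χ S ⬝ᵥ χ S = S.card := fun S => by simp [χ, dotProduct]
  have hform : ∀ S T, χ S ⬝ᵥ P.mulVec (χ T) = ∑ u ∈ S, ∑ v ∈ T, P u v := fun S T => by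
    simp [χ, dotProduct, Matrix.mulVec]
  -- Rows indexed by `S` keep all their mass inside `T`, so each contributes 1.
  have hlow : ∀ S T : Finset V, S ⊆ T → (∀ u ∈ S, ∀ v, P u v ≠ 0 → v ∈ T) →
      (S.card : ℝ) ≤ χ T ⬝ᵥ P.mulVec (χ T) := by
    intro S T hST h
    rw [hform]
    calc (S.card : ℝ) = ∑ u ∈ S, ∑ v ∈ T, P u v := by
          rw [Finset.sum_congr rfl fun u hu => ?_]
          · rw [Finset.sum_const, nsmul_one]
          · rw [← h1 u]
            refine Finset.sum_subset (Finset.subset_univ _) fun v _ hv => ?_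
            by_contra hne
            exact hv (h u hu v hne)
      _ ≤ _ := Finset.sum_le_sum_of_subset_of_nonneg hST fun u _ _ =>
          Finset.sum_nonneg fun v _ => h0 u v
  have hx : χ S₁ ⬝ᵥ χ T₁ = 0 := by
    refine Finset.sum_eq_zero fun u _ => ?_
    by_cases hu : u ∈ S₁
    · simp [χ, hdisj u hu]
    · simp [χ, hu]
  have hPx : χ S₁ ⬝ᵥ P.mulVec (χ T₁) = 0 := by
    rw [hform]
    exact Finset.sum_eq_zero fun u hu => Finset.sum_eq_zero fun v hv => hST u hu v hv
  have hPx' : χ T₁ ⬝ᵥ P.mulVec (χ S₁) = 0 := by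
    rw [hform]
    refine Finset.sum_eq_zero fun u hu => Finset.sum_eq_zero fun v hv => ?_
    rw [← hP.apply]
    simpa using hST v hv u hu
  -- The two indicators are orthogonal for both forms, so the Rayleigh quotient exceeds `c` on their
  -- whole span, and the hyperplane meets that span only in 0.
  have key : ∀ a b : ℝ, g ⬝ᵥ (a • χ S₁ + b • χ T₁) = 0 → a = 0 ∧ b = 0 := by
    intro a b hab
    have h := hg _ hab
    simp only [Matrix.mulVec_add, Matrix.mulVec_smul, dotProduct_add, add_dotProduct,
      smul_dotProduct, dotProduct_smul, smul_eq_mul, hx, dotProduct_comm (χ T₁) (χ S₁), hPx, hPx',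
      hself] at h
    have hα := (hcS.trans_le (hlow _ _ hS hSS))
    have hβ := (hcT.trans_le (hlow _ _ hT hTT))
    by_contra hne
    rw [not_and_or] at hne
    have ha := mul_le_mul_of_nonneg_left hα.le (mul_self_nonneg a)
    have hb := mul_le_mul_of_nonneg_left hβ.le (mul_self_nonneg b)
    rcases hne with hne | hne
    · have := mul_lt_mul_of_pos_left hα (mul_self_pos.2 hne)
      linarith
    · have := mul_lt_mul_of_pos_left hβ (mul_self_pos.2 hne)
      linarith
  -- A plane always meets a hyperplane: this combination is killed by `g`, so its coefficients
  -- vanish. Then `χ S₁` itself lies in the hyperplane, which is absurd.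
  have h := key (g ⬝ᵥ χ T₁) (-(g ⬝ᵥ χ S₁)) (by
    simp only [dotProduct_add, dotProduct_smul, smul_eq_mul]; ring)
  exact one_ne_zero (key 1 0 (by simp [neg_eq_zero.1 h.2])).1

theorem one_le_pow_mul_of_growth {c : ℝ} (hc : 0 ≤ c) {R : ℕ} {a : ℕ → ℝ} {n : ℝ} (h0 : 1 ≤ a 0)
    (hn : a R ≤ n) (h : ∀ r < R, a r ≤ c * a (r + 1)) : 1 ≤ c ^ R * n := by
  have : ∀ r ≤ R, a 0 ≤ c ^ r * a r := by
    intro r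
    induction r with
    | zero => simp
    | succ r ih =>
      intro hr
      calc a 0 ≤ c ^ r * a r := ih (by omega)
        _ ≤ c ^ r * (c * a (r + 1)) := mul_le_mul_of_nonneg_left (h r (by omega)) (pow_nonneg hc r)
        _ = _ := by ring
  exact h0.trans ((this R le_rfl).trans (mul_le_mul_of_nonneg_left hn (pow_nonneg hc R)))

/-- A symmetric random walk which moves an integer valued function by at most `K` per step and
whose second largest eigenvalue modulus is at most `c` lives on a state space that is exponentially
large in the spread of the function. -/
theorem one_le_pow_mul_card {V : Type} [Fintype V] [DecidableEq V]
    {P : Matrix V V ℝ} (hP : P.IsHermitian) (h0 : ∀ u v, 0 ≤ P u v) (h1 : ∀ u, ∑ v, P u v = 1)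
    (f : V → ℤ) {K : ℤ} (hK : 0 ≤ K) (hf : ∀ u v, P u v ≠ 0 → |f u - f v| ≤ K) {x y : V} {R : ℕ}
    (hR : (2 * R + 1) * K < f y - f x) {c : ℝ} (hc0 : 0 ≤ c) (hc : slem P ≤ c) :
    1 ≤ c ^ R * Fintype.card V := by
  have : Nonempty V := ⟨x⟩
  let S : ℕ → Finset V := fun r => Finset.univ.filter fun u => f u ≤ f x + r * K
  let T : ℕ → Finset V := fun r => Finset.univ.filter fun u => f y - r * K ≤ f u
  have key : ∀ r < R, ∀ s < R, ((S r).card : ℝ) ≤ c * (S (r + 1)).card ∨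
      ((T s).card : ℝ) ≤ c * (T (s + 1)).card := by
    intro r hr s hs
    by_contra! hlt
    -- Removing `R * K` at both ends of a spread above `(2 * R + 1) * K` leaves more than one step.
    have hfar : ∀ u ∈ S (r + 1), ∀ v ∈ T (s + 1), K < f v - f u := by
      intro u hu v hv
      simp only [S, T, Finset.mem_filter, Finset.mem_univ, true_and] at hu hv
      have hr' : ((r + 1 : ℕ) : ℤ) * K ≤ R * K :=
        mul_le_mul_of_nonneg_right (by exact_mod_cast hr) hK
      have hs' : ((s + 1 : ℕ) : ℤ) * K ≤ R * K :=
        mul_le_mul_of_nonneg_right (by exact_mod_cast hs) hK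
      linarith
    refine not_lt.2 hc (lt_slem_of_separated hP h0 h1 (S₀ := S r) (S₁ := S (r + 1)) (T₀ := T s)
      (T₁ := T (s + 1)) ?_ ?_ ?_ ?_ ?_ ?_ hlt.1 hlt.2)
    · intro u hu
      simp only [S, Finset.mem_filter, Finset.mem_univ, true_and] at hu ⊢
      push_cast
      linarith
    · intro u hu
      simp only [T, Finset.mem_filter, Finset.mem_univ, true_and] at hu ⊢
      push_cast
      linarith
    · intro u hu v huv
      have := abs_le.1 (hf u v huv)
      simp only [S, Finset.mem_filter, Finset.mem_univ, true_and] at hu ⊢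
      push_cast
      linarith
    · intro u hu v huv
      have := abs_le.1 (hf u v huv)
      simp only [T, Finset.mem_filter, Finset.mem_univ, true_and] at hu ⊢
      push_cast
      linarith
    · intro u hu hu'
      have := hfar u hu u hu'
      linarith
    · intro u hu v hv
      by_contra hne
      have := hfar u hu v hv
      have := abs_le.1 (hf u v hne)
      linarith
  have hone : ∀ {s : Finset V} {z : V}, z ∈ s → (1 : ℝ) ≤ s.card := fun h => by
    exact_mod_cast Finset.card_pos.2 ⟨_, h⟩
  -- One failure of growth among the `S r` forces growth of all the `T s`, so one family grows
  -- throughout.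
  by_cases hS : ∀ r < R, ((S r).card : ℝ) ≤ c * (S (r + 1)).card
  · exact one_le_pow_mul_of_growth hc0 (hone (z := x) (by simp [S]))
      (by exact_mod_cast Finset.card_le_univ _) hS
  · push Not at hS
    obtain ⟨r, hr, hlt⟩ := hS
    exact one_le_pow_mul_of_growth (a := fun s => ((T s).card : ℝ)) hc0
      (hone (z := y) (by simp [T])) (by exact_mod_cast Finset.card_le_univ _)
      fun s hs => (key r hr s hs).resolve_left (not_le.2 hlt)

/-- Ensures `0 ≤ 1 - 1 / q`, as needed for taking `R`-th powers. -/
theorem slem_nonneg {V : Type} [Fintype V] [DecidableEq V] (P : Matrix V V ℝ) : 0 ≤ slem P := by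
  have key : ∀ s : Multiset ℝ, (∀ a ∈ s, 0 ≤ a) → 0 ≤ (s.sort (· ≥ ·)).getD 1 0 := by
    intro s hs
    rw [List.getD_eq_getElem?_getD]
    rcases h : (s.sort (· ≥ ·))[1]? with _ | a
    · simp
    · exact hs a ((Multiset.mem_sort _).1 (List.mem_of_getElem? h))
  refine key _ fun a ha => ?_
  obtain ⟨z, _, rfl⟩ := Multiset.mem_map.1 ha
  exact norm_nonneg z

/-- Real form of the previous bound, with the gap `1 / q`. -/
theorem le_gap_mul_log_card {V : Type} [Fintype V] [DecidableEq V]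
    {P : Matrix V V ℝ} (hP : P.IsHermitian) (h0 : ∀ u v, 0 ≤ P u v) (h1 : ∀ u, ∑ v, P u v = 1)
    (f : V → ℤ) {K : ℤ} (hK : 0 ≤ K) (hf : ∀ u v, P u v ≠ 0 → |f u - f v| ≤ K) {x y : V} {R : ℕ}
    (hR : (2 * R + 1) * K < f y - f x) {q : ℝ} (hq : 0 < q) (hc : slem P ≤ 1 - 1 / q) :
    (R : ℝ) ≤ q * Real.log (Fintype.card V) := by
  have hslem := slem_nonneg P
  have h := one_le_pow_mul_card hP h0 h1 f hK hf hR (hslem.trans hc) hc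
  have hexp : (1 - 1 / q) ≤ Real.exp (-(1 / q)) := by
    have := Real.add_one_le_exp (-(1 / q)); linarith
  have hn : (0 : ℝ) < Fintype.card V := by
    exact_mod_cast Fintype.card_pos_iff.2 ⟨x⟩
  have h2 : 1 ≤ Real.exp (-(R / q)) * Fintype.card V := by
    refine h.trans (mul_le_mul_of_nonneg_right ?_ hn.le)
    refine (pow_le_pow_left₀ (hslem.trans hc) hexp R).trans_eq ?_
    rw [← Real.exp_nat_mul]; congr 1; ring
  have h3 := Real.log_nonneg h2
  rw [Real.log_mul (Real.exp_ne_zero _) hn.ne', Real.log_exp] at h3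
  have : (R : ℝ) / q ≤ Real.log (Fintype.card V) := by linarith
  rwa [div_le_iff₀ hq, mul_comm] at this

end FiberWalk

/-! ### Fiber graphs and the size of fibers -/

namespace FiberWalk

theorem mem_fiber {m d : ℕ} {A : Matrix (Fin m) (Fin d) ℤ} {hA : TrivialNonnegKernel A}
    {b : Fin m → ℤ} {u : Fin d → ℤ} : u ∈ fiber A hA b ↔ 0 ≤ u ∧ A.mulVec u = b := by
  simp [fiber]

/-- Each move `e` gives exactly one edge at `u`: towards `u + e` if that is a node, a loop
otherwise. Regularity makes the simple walk symmetric. -/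
theorem degree_fiberGraph {d : ℕ} (F M : Finset (Fin d → ℤ)) (u : F) :
    (fiberGraph F M).degree u = (plusMinus M).card := by
  unfold Multigraph.degree fiberGraph
  dsimp only
  rw [Finset.sum_add_distrib, Finset.sum_ite_eq, if_pos (Finset.mem_univ _),
    Finset.sum_coe_sort F (fun v => if u.1 - v ∈ plusMinus M then 1 else 0),
    ← Finset.card_filter]
  rw [← Finset.card_filter_add_card_filter_not (s := plusMinus M) (fun e => u.1 + e ∈ F)]
  congr 1
  refine Finset.card_bij' (fun v _ => v - u.1) (fun e _ => u.1 + e) ?_ ?_ ?_ ?_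
  · intro v hv
    rw [Finset.mem_filter] at hv ⊢
    refine ⟨by simpa using neg_mem_plusMinus hv.2, by simpa using hv.1⟩
  · intro e he
    rw [Finset.mem_filter] at he ⊢
    exact ⟨he.2, by simpa using neg_mem_plusMinus he.1⟩
  · intro v _; simp
  · intro e _; simp

theorem simpleWalk_fiberGraph_apply {d : ℕ} (F M : Finset (Fin d → ℤ)) (u v : F) :
    (fiberGraph F M).simpleWalk u v = ((fiberGraph F M).mult u v : ℝ) / (plusMinus M).card := by
  simp [Multigraph.simpleWalk, degree_fiberGraph]

theorem plusMinus_nonempty_of_connected {d : ℕ} {F M : Finset (Fin d → ℤ)}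
    (h : (fiberGraph F M).Connected) {x y : F} (hxy : x ≠ y) : (plusMinus M).Nonempty := by
  by_contra hM
  rw [Finset.not_nonempty_iff_eq_empty] at hM
  rcases Relation.ReflTransGen.cases_head (h.2 x y) with h | ⟨z, hz, _⟩
  · exact hxy h
  · simp [fiberGraph, hM] at hz

/-- In a connected fiber graph with spectral gap at least `1 / q`, the spread of any coordinate is
controlled by `q` and the logarithm of the number of nodes. -/
theorem le_gap_mul_log_card_fiberGraph {d : ℕ} {F M : Finset (Fin d → ℤ)}
    (h : (fiberGraph F M).Connected) (j : Fin d) {K : ℤ} (hK : 0 ≤ K)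
    (hMK : ∀ e ∈ plusMinus M, |e j| ≤ K) {x y : Fin d → ℤ} (hx : x ∈ F) (hy : y ∈ F) {R : ℕ}
    (hR : (2 * R + 1) * K < y j - x j) {q : ℝ} (hq : 0 < q)
    (hc : slem (fiberGraph F M).simpleWalk ≤ 1 - 1 / q) :
    (R : ℝ) ≤ q * Real.log F.card := by
  have hlt : x j < y j := by nlinarith [mul_nonneg (by positivity : (0 : ℤ) ≤ 2 * R + 1) hK]
  have hD : (0 : ℝ) < (plusMinus M).card := by
    have := plusMinus_nonempty_of_connected h (x := ⟨x, hx⟩) (y := ⟨y, hy⟩)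
      (fun hxy => hlt.ne (congrFun (congrArg Subtype.val hxy) j))
    exact_mod_cast this.card_pos
  have := le_gap_mul_log_card (P := (fiberGraph F M).simpleWalk) (x := ⟨x, hx⟩) (y := ⟨y, hy⟩)
    ?_ ?_ ?_ (fun u => u.1 j) hK ?_ hR hq hc
  · simpa using this
  · refine Matrix.IsHermitian.ext fun u v => ?_
    rw [simpleWalk_fiberGraph_apply, simpleWalk_fiberGraph_apply, (fiberGraph F M).symm]
    rfl
  · intro u v
    rw [simpleWalk_fiberGraph_apply]
    positivity
  · intro u
    simp_rw [simpleWalk_fiberGraph_apply]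
    rw [← Finset.sum_div, ← Nat.cast_sum, div_eq_one_iff_eq hD.ne']
    exact_mod_cast degree_fiberGraph F M u
  · intro u v huv
    by_cases he : u.1 - v.1 ∈ plusMinus M
    · exact hMK _ he
    · by_cases heq : u = v
      · subst heq; simpa using hK
      · refine absurd ?_ huv
        rw [simpleWalk_fiberGraph_apply]
        simp [fiberGraph, he, heq]

/-- The fibers of the multiples of `b` grow at most linearly. -/
theorem exists_fiber_bound {m d : ℕ} (A : Matrix (Fin m) (Fin d) ℤ) (hA : TrivialNonnegKernel A)
    (b : Fin m → ℤ) {Q : ℕ} (hQ : 0 < Q) :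
    ∃ C : ℕ, ∀ (u : Fin d → ℤ) (t : ℕ), 0 ≤ u → (Q : ℤ) • A.mulVec u = (t : ℤ) • b →
      ∀ j, u j ≤ C * t := by
  let cast : (Fin d → ℕ) →+ (Fin d → ℤ) := (Nat.castAddMonoidHom ℤ).compLeft (Fin d)
  let f : (Fin d → ℕ) × ℕ →+ (Fin m → ℤ) :=
    { toFun := fun w => (Q : ℤ) • A.mulVec (cast w.1)
      map_zero' := by simp
      map_add' := fun w w' => by simp [Matrix.mulVec_add] }
  let g : (Fin d → ℕ) × ℕ →+ (Fin m → ℤ) :=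
    { toFun := fun w => (w.2 : ℤ) • b
      map_zero' := by simp
      map_add' := fun w w' => by simp [add_smul] }
  -- The pairs `(u, t)` with `Q A u = t b` form a finitely generated monoid, so a linear bound need
  -- only be checked on generators.
  obtain ⟨S, hS⟩ := AddSubmonoid.fg_eqLocusM f g
  refine ⟨∑ s ∈ S, ∑ j, s.1 j, fun u t hu ht j => ?_⟩
  have hmem : ((fun j => (u j).toNat, t) : (Fin d → ℕ) × ℕ) ∈ f.eqLocusM g := by
    change (Q : ℤ) • A.mulVec (fun j => (((u j).toNat : ℕ) : ℤ)) = (t : ℤ) • b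
    rw [← ht]
    congr 2
    exact funext fun j => Int.toNat_of_nonneg (hu j)
  rw [← hS] at hmem
  have key : ∀ w ∈ AddSubmonoid.closure (S : Set ((Fin d → ℕ) × ℕ)),
      w.1 j ≤ (∑ s ∈ S, ∑ j, s.1 j) * w.2 := by
    intro w hw
    induction hw using AddSubmonoid.closure_induction with
    | zero => simp
    | add w w' _ _ h h' =>
      simp only [Prod.fst_add, Prod.snd_add, Pi.add_apply, mul_add]
      omega
    | mem s hs =>
      -- A generator with `t = 0` lies in the nonnegative kernel, hence vanishes; all others have `t
      -- ≥ 1`.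
      rcases Nat.eq_zero_or_pos s.2 with h0 | hpos
      · have hloc : s ∈ f.eqLocusM g := hS ▸ AddSubmonoid.subset_closure hs
        have hloc : (Q : ℤ) • A.mulVec (cast s.1) = (s.2 : ℤ) • b := hloc
        rw [h0, Nat.cast_zero, zero_smul, smul_eq_zero] at hloc
        have := hA _ (hloc.resolve_left (by exact_mod_cast hQ.ne'))
          (fun j => Int.natCast_nonneg (s.1 j))
        have := congrFun this j
        have : s.1 j = 0 := Int.natCast_eq_zero.1 this
        omega
      · calc s.1 j ≤ ∑ j, s.1 j := Finset.single_le_sum (fun _ _ => Nat.zero_le _)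
              (Finset.mem_univ j)
          _ ≤ ∑ s ∈ S, ∑ j, s.1 j := Finset.single_le_sum (f := fun s : (Fin d → ℕ) × ℕ =>
              ∑ j, s.1 j) (fun _ _ => Nat.zero_le _) hs
          _ ≤ _ := Nat.le_mul_of_pos_right _ hpos
  have := key _ hmem
  have h2 : ((u j).toNat : ℤ) ≤ (∑ s ∈ S, ∑ j, s.1 j : ℕ) * t := by exact_mod_cast this
  rwa [Int.toNat_of_nonneg (hu j)] at h2

theorem exists_card_fiber_le {m d : ℕ} (A : Matrix (Fin m) (Fin d) ℤ)
    (hA : TrivialNonnegKernel A) (b : Fin m → ℤ) {Q : ℕ} (hQ : 0 < Q) :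
    ∃ C : ℕ, ∀ (b' : Fin m → ℤ) (t : ℕ), (Q : ℤ) • b' = (t : ℤ) • b →
      (fiber A hA b').card ≤ (C * t + 1) ^ d := by
  obtain ⟨C, hC⟩ := exists_fiber_bound A hA b hQ
  refine ⟨C, fun b' t ht => ?_⟩
  have hsub : fiber A hA b' ⊆ Fintype.piFinset fun _ : Fin d => Finset.Icc (0 : ℤ) (C * t) := by
    intro u hu
    rw [mem_fiber] at hu
    rw [Fintype.mem_piFinset]
    exact fun j => Finset.mem_Icc.2 ⟨hu.1 j, hC u t hu.1 (by rw [hu.2, ht]) j⟩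
  refine (Finset.card_le_card hsub).trans_eq ?_
  have : ((C : ℤ) * t + 1 - 0).toNat = C * t + 1 := by
    rw [sub_zero]; exact_mod_cast Int.toNat_natCast (C * t + 1)
  simp only [Fintype.card_piFinset, Int.card_Icc, this, Finset.prod_const, Finset.card_univ,
    Fintype.card_fin]

end FiberWalk

/-! ### Growth estimates and integrality -/

namespace FiberWalk

/-- The `- 1` leaves room for rounding down a quotient. -/
theorem eventually_eval_log_lt (r : Polynomial ℝ) {ε : ℝ} (hε : 0 < ε) :
    ∀ᶠ Z : ℝ in Filter.atTop, r.eval (Real.log Z) < ε * Z - 1 := by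
  have hlo : (fun Z : ℝ => r.eval (Real.log Z)) =o[Filter.atTop] (id : ℝ → ℝ) := by
    have : (fun Z : ℝ => r.eval (Real.log Z)) =
        ∑ i ∈ Finset.range (r.natDegree + 1), fun Z : ℝ => r.coeff i * Real.log Z ^ i := by
      funext Z
      simp [Polynomial.eval_eq_sum_range]
    rw [this]
    exact Asymptotics.IsLittleO.sum fun i _ => Real.isLittleO_pow_log_id_atTop.const_mul_left _
  filter_upwards [hlo.bound (half_pos hε), Filter.eventually_gt_atTop (2 / ε),
    Filter.eventually_gt_atTop 0] with Z hZ hZε hZ0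
  rw [id, Real.norm_eq_abs, Real.norm_of_nonneg hZ0.le] at hZ
  have h1 := (le_abs_self _).trans hZ
  rw [div_lt_iff₀ hε] at hZε
  linarith

theorem eval_mono_of_coeff_nonneg {r : Polynomial ℝ} (hr : ∀ n, 0 ≤ r.coeff n) {a b : ℝ}
    (ha : 0 ≤ a) (hab : a ≤ b) : r.eval a ≤ r.eval b := by
  rw [Polynomial.eval_eq_sum_range, Polynomial.eval_eq_sum_range]
  exact Finset.sum_le_sum fun i _ =>
    mul_le_mul_of_nonneg_left (pow_le_pow_left₀ ha hab i) (hr i)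

theorem exists_integer_points {m d : ℕ} (A : Matrix (Fin m) (Fin d) ℤ) (b : Fin m → ℤ)
    (hdim : 0 < affineDim (relaxedFiber A b)) :
    ∃ (N : ℕ) (X Y : Fin d → ℤ) (j : Fin d), 0 < N ∧ 0 ≤ X ∧ 0 ≤ Y ∧
      A.mulVec X = (N : ℤ) • b ∧ A.mulVec Y = (N : ℤ) • b ∧ X j < Y j := by
  have hne : ¬ (relaxedFiber A b).Subsingleton := by
    intro hs
    have h0 : vectorSpan ℚ (relaxedFiber A b) = ⊥ := by
      rcases hs.eq_empty_or_singleton with h | ⟨x, h⟩ <;> simp [h]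
    rw [affineDim, direction_affineSpan, h0] at hdim
    simp at hdim
  rw [Set.not_subsingleton_iff] at hne
  obtain ⟨x, hx, y, hy, hxy⟩ := hne
  obtain ⟨j, hj⟩ := Function.ne_iff.1 hxy
  wlog hlt : x j < y j generalizing x y
  · exact this y hy x hx hxy.symm hj.symm (lt_of_le_of_ne (not_lt.1 hlt) hj.symm)
  let N : ℕ := ∏ i, (x i).den * (y i).den
  have hN : 0 < N := Finset.prod_pos fun i _ => Nat.mul_pos (x i).den_pos (y i).den_pos
  have hscale : ∀ z : Fin d → ℚ, z ∈ relaxedFiber A b → (∀ i, (z i).den ∣ N) →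
      ∃ Z : Fin d → ℤ, 0 ≤ Z ∧ A.mulVec Z = (N : ℤ) • b ∧ ∀ i, (Z i : ℚ) = N * z i := by
    intro z hz hden
    have hZ : ∀ i, ∃ c : ℤ, (c : ℚ) = N * z i := by
      intro i
      obtain ⟨e, he⟩ := hden i
      refine ⟨e * (z i).num, ?_⟩
      rw [he]
      push_cast
      rw [mul_comm ((z i).den : ℚ), mul_assoc, Rat.den_mul_eq_num]
    choose Z hZ using hZ
    refine ⟨Z, fun i => ?_, ?_, hZ⟩
    · have : (0 : ℚ) ≤ Z i := by rw [hZ]; exact mul_nonneg (Nat.cast_nonneg _) (hz.1 i)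
      exact_mod_cast this
    · funext i
      have h := congrFun hz.2 i
      have : ((A.mulVec Z i : ℤ) : ℚ) = ((N : ℤ) • b) i := by
        simp only [Matrix.mulVec, dotProduct, Matrix.map_apply, Pi.smul_apply, smul_eq_mul] at h ⊢
        push_cast
        rw [← h, Finset.mul_sum]
        refine Finset.sum_congr rfl fun l _ => ?_
        rw [hZ]; ring
      exact_mod_cast this
  obtain ⟨X, hX0, hX, hXx⟩ := hscale x hx fun i =>
    (Dvd.intro _ rfl).trans (Finset.dvd_prod_of_mem _ (Finset.mem_univ i))
  obtain ⟨Y, hY0, hY, hYy⟩ := hscale y hy fun i =>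
    (Dvd.intro_left _ rfl).trans (Finset.dvd_prod_of_mem _ (Finset.mem_univ i))
  refine ⟨N, X, Y, j, hN, hX0, hY0, hX, hY, ?_⟩
  have : (X j : ℚ) < Y j := by
    rw [hXx, hYy]
    exact mul_lt_mul_of_pos_left hlt (by exact_mod_cast hN)
  exact_mod_cast this

theorem exists_integer_polynomial (p : Polynomial ℚ) :
    ∃ (Q : ℕ) (P : Polynomial ℤ), 0 < Q ∧
      ∀ k : ℕ, ((P.eval (k : ℤ) : ℤ) : ℚ) = Q * p.eval (k : ℚ) := by
  obtain ⟨c, hc, h⟩ := IsLocalization.integerNormalization_spec (nonZeroDivisors ℤ) p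
  set P := IsLocalization.integerNormalization (nonZeroDivisors ℤ) p
  -- The factor `c.sign` turns the common denominator `c` into the positive `|c|`.
  refine ⟨c.natAbs, Polynomial.C c.sign * P, Int.natAbs_pos.2 (nonZeroDivisors.ne_zero hc),
    fun k => ?_⟩
  have hP : ((P.eval (k : ℤ) : ℤ) : ℚ) = c * p.eval (k : ℚ) := by
    have := congrArg (Polynomial.eval (k : ℚ)) h
    rw [Polynomial.eval_smul, zsmul_eq_mul] at this
    rw [← this]
    simp
  rw [Polynomial.eval_mul, Polynomial.eval_C, Int.cast_mul, hP, ← mul_assoc]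
  congr 1
  have := Int.sign_mul_self c
  rw [← Int.cast_mul, this]
  simp

/-- If `p(k) < 0`, a nonnegative `v` over `p(k) • b` and `u` over `b` combine to the nonnegative
kernel element `Q v - P(k) u`. It vanishes, forcing `u = 0` and `b = 0`. -/
theorem tendsto_eval_atTop {m d : ℕ} {A : Matrix (Fin m) (Fin d) ℤ}
    (hA : TrivialNonnegKernel A) {b : Fin m → ℤ} (hb0 : b ≠ 0) {u : Fin d → ℤ} (hu0 : 0 ≤ u)
    (hu : A.mulVec u = b) {p : Polynomial ℚ} (hp : 0 < p.natDegree)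
    (h : ∀ k : ℕ, ∃ v : Fin d → ℤ, 0 ≤ v ∧ ∀ i, ((A.mulVec v i : ℤ) : ℚ) = p.eval (k : ℚ) * b i) :
    Filter.Tendsto (fun x : ℚ => p.eval x) Filter.atTop Filter.atTop := by
  refine Polynomial.tendsto_atTop_of_leadingCoeff_nonneg p
    (Polynomial.natDegree_pos_iff_degree_pos.1 hp) ?_
  by_contra! hlc
  have hbot := (Polynomial.tendsto_atBot_of_leadingCoeff_nonpos p
    (Polynomial.natDegree_pos_iff_degree_pos.1 hp) hlc.le).comp
      (tendsto_natCast_atTop_atTop (R := ℚ))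
  obtain ⟨k, hk⟩ := (hbot.eventually (Filter.eventually_lt_atBot 0)).exists
  obtain ⟨Q, P, hQ, hP⟩ := exists_integer_polynomial p
  have hPk : P.eval (k : ℤ) < 0 := by
    have : ((P.eval (k : ℤ) : ℤ) : ℚ) < 0 := by
      rw [hP]; exact mul_neg_of_pos_of_neg (by exact_mod_cast hQ) hk
    exact_mod_cast this
  obtain ⟨v, hv0, hv⟩ := h k
  have hker := hA ((Q : ℤ) • v + (-P.eval (k : ℤ)) • u) ?_ ?_
  · apply hb0
    rw [← hu, ← Matrix.mulVec_zero A]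
    congr 1
    funext l
    have hl := congrFun hker l
    simp only [Pi.add_apply, Pi.smul_apply, smul_eq_mul, Pi.zero_apply] at hl ⊢
    have h1 : 0 ≤ (Q : ℤ) * v l := mul_nonneg (Int.natCast_nonneg _) (hv0 l)
    have h2 : 0 ≤ -P.eval (k : ℤ) * u l := mul_nonneg (by omega) (hu0 l)
    have h3 : -P.eval (k : ℤ) * u l = 0 := by omega
    exact (mul_eq_zero.1 h3).resolve_left (by omega)
  · funext i
    have : ((A.mulVec ((Q : ℤ) • v + (-P.eval (k : ℤ)) • u) i : ℤ) : ℚ) = 0 := by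
      rw [Matrix.mulVec_add, Matrix.mulVec_smul, Matrix.mulVec_smul, hu]
      simp only [Pi.add_apply, Pi.smul_apply, smul_eq_mul, Int.cast_add, Int.cast_mul, hv,
        Int.cast_neg, hP, Int.cast_natCast]
      ring
    exact_mod_cast this
  · exact add_nonneg (smul_nonneg (Int.natCast_nonneg _) hv0) (smul_nonneg (by omega) hu0)

end FiberWalk

/-! ### The contradiction -/

theorem corollaryc {m d : ℕ} (A : Matrix (Fin m) (Fin d) ℤ)
    (hA : FiberWalk.TrivialNonnegKernel A)
    (M : Finset (Fin d → ℤ)) (hM : FiberWalk.IsMarkovBasis A hA M)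
    (b : Fin m → ℤ) (hb : b ∈ FiberWalk.affineSemigroup A)
    (hdim : 0 < FiberWalk.affineDim (FiberWalk.relaxedFiber A b))
    (bs : ℕ → Fin m → ℤ) (hbs : ∀ i, bs i ∈ FiberWalk.affineSemigroup A)
    (p : Polynomial ℚ) (hp : 0 < p.natDegree)
    (hsub : ∃ φ : ℕ → ℕ, StrictMono φ ∧
      ∀ k : ℕ, ∀ j : Fin m, ((bs (φ k) j : ℤ) : ℚ) = p.eval (k : ℚ) * (b j : ℚ)) :
    ¬ FiberWalk.RapidlyMixing
      (fun i => FiberWalk.fiberGraph (FiberWalk.fiber A hA (bs i)) M) := by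
  open FiberWalk in
  rintro ⟨q, hq0, hq⟩
  obtain ⟨φ, -, hφ⟩ := hsub
  obtain ⟨N, X, Y, j, hN, hX0, hY0, hX, hY, hXY⟩ := exists_integer_points A b hdim
  obtain ⟨Q, P, hQ, hP⟩ := exists_integer_polynomial p
  have hb0 : b ≠ 0 := by
    rintro rfl
    rw [smul_zero] at hX hY
    rw [hA X hX hX0, hA Y hY hY0] at hXY
    exact lt_irrefl _ hXY
  have hne : ∀ b' ∈ affineSemigroup A, ∃ u, 0 ≤ u ∧ A.mulVec u = b' := fun b' hb' => by
    obtain ⟨u, hu⟩ := (hM.2 b' hb').1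
    exact ⟨u, mem_fiber.1 hu⟩
  obtain ⟨u, hu0, hu⟩ := hne b hb
  have htend := tendsto_eval_atTop hA hb0 hu0 hu hp fun k => by
    obtain ⟨v, hv0, hv⟩ := hne _ (hbs (φ k))
    exact ⟨v, hv0, fun i => by rw [hv, hφ]⟩
  obtain ⟨v, hv0, hv⟩ := hne _ (hbs (φ 0))
  obtain ⟨C, hC⟩ := exists_card_fiber_le A hA b hQ
  obtain ⟨K, hK1, hK⟩ : ∃ K : ℤ, 1 ≤ K ∧ ∀ e ∈ plusMinus M, |e j| ≤ K := by
    refine ⟨1 + ∑ e ∈ plusMinus M, |e j|, ?_, fun e he => ?_⟩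
    · have : 0 ≤ ∑ e ∈ plusMinus M, |e j| := Finset.sum_nonneg fun _ _ => abs_nonneg _
      omega
    · have := Finset.single_le_sum (f := fun e : Fin d → ℤ => |e j|) (fun _ _ => abs_nonneg _) he
      omega
  -- `P(k) - P(0)` is divisible by `k`, hence by `Q * N`; so `p(k) - p(0)` is an integer multiple of
  -- `N`.
  have hz : ∀ τ : ℕ, ∃ z : ℤ, P.eval ((Q * N * τ : ℕ) : ℤ) = P.eval 0 + Q * N * z := fun τ => by
    obtain ⟨w, hw⟩ := Polynomial.sub_dvd_eval_sub ((Q * N * τ : ℕ) : ℤ) 0 P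
    refine ⟨τ * w, ?_⟩
    rw [sub_zero] at hw
    push_cast at hw ⊢
    linarith
  choose z hz using hz
  have hpz : ∀ τ : ℕ, p.eval ((Q * N * τ : ℕ) : ℚ) = p.eval 0 + N * z τ := fun τ => by
    have hQ' : (Q : ℚ) ≠ 0 := by exact_mod_cast hQ.ne'
    have h0 := hP 0
    have h1 := hP (Q * N * τ)
    rw [hz] at h1
    push_cast at h0 h1 ⊢
    apply mul_left_cancel₀ hQ'
    rw [← h1, h0]
    ring
  have hzt : Filter.Tendsto z Filter.atTop Filter.atTop := by
    have h1 : Filter.Tendsto (fun τ : ℕ => Q * N * τ) Filter.atTop Filter.atTop :=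
      Filter.tendsto_id.const_mul_atTop' (Nat.mul_pos hQ hN)
    have h2 := htend.comp ((tendsto_natCast_atTop_atTop (R := ℚ)).comp h1)
    have h3 : Filter.Tendsto (fun τ => (z τ : ℚ)) Filter.atTop Filter.atTop := by
      have h4 := (Filter.tendsto_atTop_add_const_right _ (-p.eval 0) h2).atTop_div_const
        (r := (N : ℚ)) (by exact_mod_cast hN)
      refine h4.congr fun τ => ?_
      have hN' : (N : ℚ) ≠ 0 := by exact_mod_cast hN.ne'
      simp only [Function.comp_apply]
      rw [hpz]
      field_simp
      ring
    exact tendsto_intCast_atTop_iff.1 h3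
  -- Chosen so that `C * P(k) + 1 ≤ B * z` as soon as `z ≥ 1`.
  set B : ℤ := C * (Q * N + |P.eval 0|) + 1 with hB
  have hB1 : 1 ≤ B := by
    have : 0 ≤ (C : ℤ) * (Q * N + |P.eval 0|) := by positivity
    omega
  have hBR : (0 : ℝ) < B := by exact_mod_cast hB1
  have hKR : (0 : ℝ) < K := by exact_mod_cast hK1
  set r₀ : Polynomial ℝ := q.map (algebraMap ℚ ℝ) with hr₀
  have hr₀n : ∀ n, 0 ≤ r₀.coeff n := fun n => by
    rw [hr₀, Polynomial.coeff_map]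
    simpa using hq0 n
  have hev := eventually_eval_log_lt ((r₀ * Polynomial.X).comp (Polynomial.C (d : ℝ) * Polynomial.X))
    (ε := 1 / (4 * K * B)) (by positivity)
  have hBz : Filter.Tendsto (fun τ => (B : ℝ) * z τ) Filter.atTop Filter.atTop :=
    (tendsto_intCast_atTop_atTop.comp hzt).const_mul_atTop hBR
  -- `z > 2K` gives `(2R + 1) K < z` for `R = ⌊z / (4K)⌋`, and `z ≥ |P(0)|` gives `P(k) ≥ 0`.
  obtain ⟨τ, h1, h2, h3⟩ := ((hBz.eventually hev).and
    ((hzt.eventually (Filter.eventually_gt_atTop (2 * K))).and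
      (hzt.eventually (Filter.eventually_ge_atTop |P.eval 0|)))).exists
  set k := Q * N * τ with hk
  set F := fiber A hA (bs (φ k)) with hF
  have hmem : ∀ Z : Fin d → ℤ, 0 ≤ Z → A.mulVec Z = (N : ℤ) • b → v + z τ • Z ∈ F := by
    intro Z hZ0 hZ
    refine mem_fiber.2 ⟨add_nonneg hv0 (smul_nonneg (by omega) hZ0), ?_⟩
    rw [Matrix.mulVec_add, Matrix.mulVec_smul, hv, hZ]
    funext i
    have : (((bs (φ 0) + z τ • (N : ℤ) • b) i : ℤ) : ℚ) = (bs (φ k) i : ℤ) := by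
      simp only [Pi.add_apply, Pi.smul_apply, smul_eq_mul, Int.cast_add, Int.cast_mul, hφ]
      rw [hk, hpz]
      push_cast
      ring
    exact_mod_cast this
  set R : ℕ := (z τ / (4 * K)).toNat with hRdef
  have hRc : (R : ℤ) = z τ / (4 * K) := Int.toNat_of_nonneg (Int.ediv_nonneg (by omega) (by omega))
  have hR1 : (R : ℤ) * (4 * K) ≤ z τ := by rw [hRc]; exact Int.ediv_mul_le _ (by omega)
  have hR2 : z τ < (R + 1 : ℤ) * (4 * K) := by
    rw [hRc]; exact Int.lt_ediv_add_one_mul_self _ (by omega)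
  have hqk := hq (φ k)
  have haeval : ∀ x : ℝ, Polynomial.aeval x q = r₀.eval x := fun x => by
    rw [hr₀, Polynomial.eval_map_algebraMap]
  rw [haeval, Fintype.card_coe] at hqk
  have hmain := le_gap_mul_log_card_fiberGraph (hM.2 _ (hbs (φ k))) j (by omega : 0 ≤ K) hK
    (hmem X hX0 hX) (hmem Y hY0 hY) (R := R) (by
      simp only [Pi.add_apply, Pi.smul_apply, smul_eq_mul]
      have : z τ * 1 ≤ z τ * (Y j - X j) := mul_le_mul_of_nonneg_left (by omega) (by omega)
      linarith) hqk.1 hqk.2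
  have hcard : (F.card : ℝ) ≤ (B * z τ) ^ d := by
    have hzpos : 1 ≤ z τ := by omega
    have hPk : 0 ≤ P.eval (k : ℤ) := by
      rw [hk, hz]
      have hQN : (1 : ℤ) ≤ Q * N := by exact_mod_cast Nat.mul_pos hQ hN
      have := mul_le_mul_of_nonneg_right hQN (by omega : 0 ≤ z τ)
      have := neg_abs_le (P.eval 0)
      linarith
    have hle := hC (bs (φ k)) (P.eval (k : ℤ)).toNat (by
      rw [Int.toNat_of_nonneg hPk]
      funext i
      have : (((Q : ℤ) • bs (φ k)) i : ℚ) = ((P.eval (k : ℤ)) • b) i := by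
        simp only [Pi.smul_apply, smul_eq_mul, Int.cast_mul, hφ, hP]
        push_cast
        ring
      exact_mod_cast this)
    have hint : (C * (P.eval (k : ℤ)).toNat + 1 : ℤ) ≤ B * z τ := by
      rw [Int.toNat_of_nonneg hPk, hk, hz, hB]
      have ha : P.eval 0 ≤ |P.eval 0| * z τ :=
        (le_abs_self _).trans (le_mul_of_one_le_right (abs_nonneg _) hzpos)
      have := mul_le_mul_of_nonneg_left ha (Int.natCast_nonneg C)
      linarith
    calc (F.card : ℝ) ≤ ((C * (P.eval (k : ℤ)).toNat + 1 : ℤ) : ℝ) ^ d := by exact_mod_cast hle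
      _ ≤ _ := pow_le_pow_left₀ (by positivity) (by exact_mod_cast hint) d
  have hFpos : (1 : ℝ) ≤ F.card := by
    exact_mod_cast Finset.card_pos.2 ⟨_, hmem X hX0 hX⟩
  have hlog : Real.log F.card ≤ d * Real.log (B * z τ) := by
    rw [← Real.log_pow]
    exact Real.log_le_log (by linarith) hcard
  have hlog0 := Real.log_nonneg hFpos
  -- The left side is at least `R`; by `h1` the right side is below `z / (4K) - 1`, which is less
  -- than `R`.
  have hfin : r₀.eval (Real.log F.card) * Real.log F.card ≤
      r₀.eval (d * Real.log (B * z τ)) * (d * Real.log (B * z τ)) :=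
    mul_le_mul (eval_mono_of_coeff_nonneg hr₀n hlog0 hlog) hlog hlog0
      (hqk.1.le.trans (eval_mono_of_coeff_nonneg hr₀n hlog0 hlog))
  simp only [Polynomial.eval_comp, Polynomial.eval_mul, Polynomial.eval_X, Polynomial.eval_C] at h1
  have hR2' : (z τ : ℝ) < (R + 1) * (4 * K) := by exact_mod_cast hR2
  have : 1 / (4 * K * B) * (B * z τ) = (z τ : ℝ) / (4 * K) := by field_simp
  rw [this] at h1
  have := (div_lt_iff₀ (by positivity : (0 : ℝ) < 4 * K)).2 hR2'
  linarith
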